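/- All posets are finite and graded, with a unique minimal element $\hat 0$, a unique maximal element $\hat 1$, and rank function $\rho$ ($\rho(\hat 0)=0$, and $\rho$ increases by one along each covering relation); the rank of the poset is $\rho(\hat 1)$. An $n$-interval is an interval $[x,y]$ with $\rho(y)-\rho(x)=n$. Such a poset $P$ is a Sheffer poset, with binomial factorial function $B$ and Sheffer factorial function $D$, if every $n$-interval $[\hat 0,y]$ has exactly $D(n)$ maximal chains and every $n$-interval $[x,y]$ with $x\neq\hat 0$ has exactly $B(n)$ maximal chains. It is Eulerian if every non-singleton interval has as many elements of even rank as elements of odd rank. Lemma. Let $P$ be an Eulerian Sheffer poset of rank $n\ge 6$ with binomial factorial function $B$ and Sheffer factorial function $D$. If $B(3)=3!=6$, then $D(3)\in\{4,6,8\}$. -/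

import Mathlib

/-- `[x, y]` is an `n`-interval of a graded poset: `x ≤ y` and `ρ(y) = ρ(x) + n`, where the
rank function `ρ = grade ℕ` increases by one along covering relations and is `0` at the minimum. -/
def IsNInterval {P : Type*} [PartialOrder P] [OrderBot P] [GradeMinOrder ℕ P]
    (n : ℕ) (x y : P) : Prop :=
  x ≤ y ∧ grade ℕ y = grade ℕ x + n

/-- The number of maximal chains of the interval `[x, y]`. -/
noncomputable def numMaxChains {P : Type*} [PartialOrder P] (x y : P) : ℕ :=
  Nat.card (Flag (Set.Icc x y))

/-- The finite graded poset `P` with `0̂` and `1̂` is a Sheffer poset with binomial factorial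
function `B` and Sheffer factorial function `D`. (Only the values of `B` and `D` at those `n`
for which `P` has an `n`-interval of the relevant kind are constrained.) -/
structure IsShefferPoset (P : Type*) [PartialOrder P] [BoundedOrder P] [Finite P]
    [GradeMinOrder ℕ P] (B D : ℕ → ℕ) : Prop where
  /-- Every `n`-interval `[0̂, y]` has `D n` maximal chains. -/
  sheffer : ∀ (n : ℕ) (y : P), IsNInterval n ⊥ y → numMaxChains ⊥ y = D n
  /-- Every `n`-interval `[x, y]` with `x ≠ 0̂` has `B n` maximal chains. -/
  binomial : ∀ (n : ℕ) (x y : P), x ≠ ⊥ → IsNInterval n x y → numMaxChains x y = B n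

/-- A finite graded poset is Eulerian if every non-singleton interval has as many elements of
even rank as elements of odd rank. -/
def IsEulerianPoset (P : Type*) [PartialOrder P] [BoundedOrder P] [Finite P]
    [GradeMinOrder ℕ P] : Prop :=
  ∀ x y : P, x < y →
    {z ∈ Set.Icc x y | Even (grade ℕ z)}.ncard = {z ∈ Set.Icc x y | Odd (grade ℕ z)}.ncard

/-! Cutting maximal chains at a fixed rank turns the Sheffer axioms into product formulas: a level
of `[x, y]`, times the chain counts below and above it, gives the chain count of `[x, y]`. With the
Euler relation, these determine the small values `B 4 = 24`, `D 1 = 1`, `D 2 = 2`.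

In a rank four interval `[⊥, y]` the level sizes are `2e, 3e, e + 2`, and `D 3 = 2q` with `q (e + 2)
= 6e`. Hence `q` is 2, 3, 4 or 5, and only `q = 5`, the case with the level sizes 20, 30, 12 of a
dodecahedron, must be excluded (`not_dodecahedral`).

For this, take `b < t` of ranks 1 and 6, and let `c` be the number of atoms of `[b, t]`. A
pigeonhole argument excludes `c = 6` and `c = 7` (`card_level_le_five_or`). The Euler relation on
`[⊥, t]` reads `f1 + f5 = 2 + 2 f4`, where `f1 c = 10 f4`: for `c ≥ 8` the left side is too small,
for `c ≤ 5` too large. -/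

section ShefferPosets

/-! ### Maximal chains of intervals -/

variable {P : Type*} [PartialOrder P]

/-- `s` is a maximal chain of `[x, y]`. -/
abbrev IsMaxChainIcc (x y : P) (s : Set P) : Prop :=
  Maximal (fun s => s ⊆ Set.Icc x y ∧ IsChain (· ≤ ·) s) s

/-- Viewing flags of the subtype as subsets of `P` lets chains of different intervals be compared.
-/
theorem numMaxChains_eq_ncard (x y : P) :
    numMaxChains x y = {s | IsMaxChainIcc x y s}.ncard := by
  rw [numMaxChains, ← Nat.card_coe_set_eq]
  have hs (s : {s | IsMaxChainIcc x y s}) : IsMaxChainIcc x y s.1 := s.2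
  refine Nat.card_congr ⟨fun F => ⟨Subtype.val '' (F : Set (Set.Icc x y)), ?_⟩,
    fun s => ⟨Subtype.val ⁻¹' s.1, ?_, ?_⟩, ?_, ?_⟩
  · refine ⟨⟨by rintro _ ⟨a, -, rfl⟩; exact a.2, ?_⟩, ?_⟩
    · rintro _ ⟨a, ha, rfl⟩ _ ⟨b, hb, rfl⟩ hab
      exact F.Chain' ha hb (fun h => hab (congrArg _ h))
    · rintro t ⟨ht, htc⟩ hFt
      have h := F.max_chain' (s := Subtype.val ⁻¹' t)
        (fun a ha b hb hab => htc ha hb (fun h => hab (Subtype.ext h)))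
        (fun a ha => hFt ⟨a, ha, rfl⟩)
      intro u hu
      refine ⟨⟨u, ht hu⟩, ?_, rfl⟩
      have : (⟨u, ht hu⟩ : Set.Icc x y) ∈ (F.carrier) := by rw [h]; exact hu
      exact this
  · intro a ha b hb hab
    exact (hs s).prop.2 ha hb (fun h => hab (Subtype.ext h))
  · intro t htc hst
    refine hst.antisymm fun a ha => ?_
    have h1 : s.1 ⊆ Subtype.val '' t := fun u hu =>
      ⟨⟨u, (hs s).prop.1 hu⟩, hst hu, rfl⟩
    refine (hs s).le_of_ge (y := Subtype.val '' t) ⟨?_, ?_⟩ h1 ⟨a, ha, rfl⟩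
    · rintro _ ⟨a, -, rfl⟩; exact a.2
    · rintro _ ⟨a, ha, rfl⟩ _ ⟨b, hb, rfl⟩ hab
      exact htc ha hb (fun h => hab (congrArg _ h))
  · intro F
    apply Flag.ext
    ext a
    simp
  · intro s
    apply Subtype.ext
    ext u
    simp only [Set.mem_image]
    exact ⟨by rintro ⟨a, ha, rfl⟩; exact ha, fun hu => ⟨⟨u, (hs s).prop.1 hu⟩, hu, rfl⟩⟩

theorem mem_of_isMaxChainIcc {x y u : P} {s : Set P} (hs : IsMaxChainIcc x y s)
    (hu : u ∈ Set.Icc x y) (h : ∀ v ∈ s, u ≤ v ∨ v ≤ u) : u ∈ s :=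
  hs.le_of_ge (y := insert u s) ⟨Set.insert_subset hu hs.prop.1,
    hs.prop.2.insert fun v hv _ => h v hv⟩ (Set.subset_insert _ _) (Set.mem_insert _ _)

theorem right_mem_of_isMaxChainIcc {x y : P} {s : Set P} (hs : IsMaxChainIcc x y s)
    (hxy : x ≤ y) : y ∈ s :=
  mem_of_isMaxChainIcc hs ⟨hxy, le_rfl⟩ fun _ hv => Or.inr (hs.prop.1 hv).2

theorem left_mem_of_isMaxChainIcc {x y : P} {s : Set P} (hs : IsMaxChainIcc x y s)
    (hxy : x ≤ y) : x ∈ s :=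
  mem_of_isMaxChainIcc hs ⟨le_rfl, hxy⟩ fun _ hv => Or.inl (hs.prop.1 hv).1

/-- This and the next lemma are the two directions of the recursion over coatoms: adding the top to
a maximal chain, and removing it. -/
theorem isMaxChainIcc_insert {x w y : P} {s : Set P} (hs : IsMaxChainIcc x w s)
    (hxw : x ≤ w) (hwy : w ⋖ y) : IsMaxChainIcc x y (insert y s) := by
  have hsy : ∀ v ∈ s, v ≤ y := fun v hv => (hs.prop.1 hv).2.trans hwy.le
  refine ⟨⟨Set.insert_subset ⟨hxw.trans hwy.le, le_rfl⟩
    fun v hv => ⟨(hs.prop.1 hv).1, hsy v hv⟩, hs.prop.2.insert fun v hv _ => Or.inr (hsy v hv)⟩, ?_⟩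
  rintro t ⟨ht, htc⟩ hst u hu
  by_cases huy : u = y
  · exact Or.inl huy
  right
  have hws : w ∈ s := right_mem_of_isMaxChainIcc hs hxw
  have key : ∀ v ∈ t, v ≠ y → v ≤ w := by
    intro v hv hvy
    rcases htc.total hv (hst (Or.inr hws)) with h | h
    · exact h
    · rcases h.eq_or_lt with h | h
      · exact h.ge
      · exact absurd (lt_of_le_of_ne (ht hv).2 hvy) (hwy.2 h)
  refine hs.le_of_ge (y := t \ {y}) ⟨fun v hv => ⟨(ht hv.1).1, key v hv.1 hv.2⟩,
    htc.mono Set.sdiff_subset⟩ (fun v hv => ⟨hst (Or.inr hv), ?_⟩) ⟨hu, huy⟩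
  rintro rfl
  exact hwy.lt.not_ge (hs.prop.1 hv).2

theorem exists_eq_insert_of_isMaxChainIcc [Finite P] {x y : P} {s : Set P}
    (hs : IsMaxChainIcc x y s) (hxy : x < y) :
    ∃ w, x ≤ w ∧ w ⋖ y ∧ ∃ t, IsMaxChainIcc x w t ∧ insert y t = s := by
  have hy := right_mem_of_isMaxChainIcc hs hxy.le
  have hx := left_mem_of_isMaxChainIcc hs hxy.le
  obtain ⟨w, hw⟩ := (Set.toFinite (s \ {y})).exists_maximal ⟨x, hx, hxy.ne⟩
  have hlt : w < y := lt_of_le_of_ne (hs.prop.1 hw.prop.1).2 hw.prop.2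
  have hle : ∀ v ∈ s, v ≠ y → v ≤ w := by
    intro v hv hvy
    rcases hs.prop.2.total hv hw.prop.1 with h | h
    · exact h
    · exact hw.le_of_ge ⟨hv, hvy⟩ h
  have hxw := hle x hx hxy.ne
  have hins : insert y (s \ {y}) = s := by
    rw [Set.insert_sdiff_singleton, Set.insert_eq_of_mem hy]
  refine ⟨w, hxw, ⟨hlt, fun u hwu huy => ?_⟩, s \ {y}, ⟨⟨fun v hv =>
    ⟨(hs.prop.1 hv.1).1, hle v hv.1 hv.2⟩, hs.prop.2.mono Set.sdiff_subset⟩, ?_⟩, hins⟩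
  · have hu : u ∈ s := mem_of_isMaxChainIcc hs ⟨hxw.trans hwu.le, huy.le⟩ fun v hv => by
      by_cases hvy : v = y
      · exact Or.inl (hvy ▸ huy.le)
      · exact Or.inr ((hle v hv hvy).trans hwu.le)
    exact hwu.not_ge (hle u hu huy.ne)
  · rintro t ⟨ht, htc⟩ hst u hu
    have huy : u ≠ y := fun h => hlt.not_ge (h ▸ (ht hu).2)
    refine ⟨hs.le_of_ge (y := insert y t) ⟨Set.insert_subset ⟨hxy.le, le_rfl⟩ fun v hv =>
      ⟨(ht hv).1, (ht hv).2.trans hlt.le⟩, htc.insert fun v hv _ =>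
      Or.inr ((ht hv).2.trans hlt.le)⟩ ?_ (Or.inr hu), huy⟩
    rw [← hins]
    exact Set.insert_subset_insert hst

theorem numMaxChains_self (x : P) : numMaxChains x x = 1 := by
  rw [numMaxChains_eq_ncard, Set.ncard_eq_one]
  refine ⟨{x}, Set.eq_singleton_iff_unique_mem.2 ⟨⟨⟨by simp, by simp⟩, ?_⟩, ?_⟩⟩
  · rintro t ⟨ht, -⟩ -
    simpa using ht
  · intro s (hs : IsMaxChainIcc x x s)
    have := hs.prop.1
    rw [Set.Icc_self] at this
    exact this.antisymm (Set.singleton_subset_iff.2 (right_mem_of_isMaxChainIcc hs le_rfl))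

theorem numMaxChains_pos [Finite P] (x y : P) : 0 < numMaxChains x y := by
  have : Finite (Flag (Set.Icc x y)) := Finite.of_injective _ SetLike.coe_injective
  exact Nat.card_pos

/-! ### Levels and double counting of chains -/

section Levels

variable [GradeMinOrder ℕ P]

theorem grade_eq_add_one_of_covBy {x y : P} (h : x ⋖ y) : grade ℕ y = grade ℕ x + 1 :=
  (Nat.covBy_iff_add_one_eq.1 (h.grade ℕ)).symm

theorem eq_of_le_of_grade_le {x y : P} (h : x ≤ y) (hg : grade ℕ y ≤ grade ℕ x) : x = y := by
  by_contra hne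
  exact (grade_strictMono (𝕆 := ℕ) (lt_of_le_of_ne h hne)).not_ge hg

theorem grade_le_grade_of_le {x y : P} (h : x ≤ y) : grade ℕ x ≤ grade ℕ y :=
  grade_strictMono.monotone h

theorem covBy_of_le_of_grade {x y : P} (h : x ≤ y) (hg : grade ℕ y = grade ℕ x + 1) : x ⋖ y := by
  refine ⟨lt_of_le_of_ne h (by rintro rfl; omega), fun u h1 h2 => ?_⟩
  have := grade_strictMono (𝕆 := ℕ) h1
  have := grade_strictMono (𝕆 := ℕ) h2
  omega

variable [Finite P]

/-- The elements of grade `k` in `[x, y]`. -/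
noncomputable def level (x y : P) (k : ℕ) : Finset P :=
  (Set.toFinite {z : P | x ≤ z ∧ z ≤ y ∧ grade ℕ z = k}).toFinset

@[simp]
theorem mem_level {x y z : P} {k : ℕ} : z ∈ level x y k ↔ x ≤ z ∧ z ≤ y ∧ grade ℕ z = k := by
  simp [level]

theorem level_left {x y : P} (h : x ≤ y) : level x y (grade ℕ x) = {x} := by
  ext z
  simp only [mem_level, Finset.mem_singleton]
  refine ⟨fun hz => (eq_of_le_of_grade_le hz.1 hz.2.2.le).symm, ?_⟩
  rintro rfl
  exact ⟨le_rfl, h, rfl⟩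

theorem level_right {x y : P} (h : x ≤ y) : level x y (grade ℕ y) = {y} := by
  ext z
  simp only [mem_level, Finset.mem_singleton]
  refine ⟨fun hz => eq_of_le_of_grade_le hz.2.1 hz.2.2.ge, ?_⟩
  rintro rfl
  exact ⟨h, le_rfl, rfl⟩

theorem level_subset {x x' y y' : P} (hx : x' ≤ x) (hy : y ≤ y') (k : ℕ) :
    level x y k ⊆ level x' y' k := by
  intro z hz
  rw [mem_level] at hz ⊢
  exact ⟨hx.trans hz.1, hz.2.1.trans hy, hz.2.2⟩

/-- A maximal chain of `[x, y]` is a maximal chain of `[x, w]`, for a unique coatom `w`,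
together with `y`. -/
theorem numMaxChains_eq_sum_coatoms {x y : P} (hxy : x < y) {k : ℕ} (hk : grade ℕ y = k + 1) :
    numMaxChains x y = ∑ w ∈ level x y k, numMaxChains x w := by
  classical
  have hset : {s | IsMaxChainIcc x y s} =
      ⋃ w ∈ level x y k, insert y '' {s | IsMaxChainIcc x w s} := by
    ext s
    simp only [Set.mem_iUnion, Set.mem_image, mem_level, exists_prop, Set.mem_ofPred_eq]
    constructor
    · intro hs
      obtain ⟨w, hxw, hwy, t, ht, rfl⟩ := exists_eq_insert_of_isMaxChainIcc hs hxy
      have := grade_eq_add_one_of_covBy hwy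
      exact ⟨w, ⟨hxw, hwy.le, by omega⟩, t, ht, rfl⟩
    · rintro ⟨w, ⟨hxw, hwy, hw⟩, t, ht, rfl⟩
      exact isMaxChainIcc_insert ht hxw (covBy_of_le_of_grade hwy (by omega))
  -- Since the top is not in the shorter chain, deleting it recovers that chain; this gives both
  -- injectivity and disjointness below.
  have hnot : ∀ w ∈ level x y k, ∀ t, IsMaxChainIcc x w t → y ∉ t := by
    intro w hw t ht hy
    rw [mem_level] at hw
    have := grade_le_grade_of_le (ht.prop.1 hy).2
    omega
  simp only [numMaxChains_eq_ncard]
  have hinj : ∀ w ∈ level x y k, Set.InjOn (insert y) {s | IsMaxChainIcc x w s} := by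
    intro w hw t ht t' ht' h
    have h1 := hnot w hw t ht
    have h2 := hnot w hw t' ht'
    rw [← Set.insert_sdiff_self_of_notMem h1, h, Set.insert_sdiff_self_of_notMem h2]
  have hunion : (Set.toFinite (⋃ w ∈ level x y k, insert y '' {s | IsMaxChainIcc x w s})).toFinset =
      (level x y k).biUnion
        fun w => (Set.toFinite (insert y '' {s | IsMaxChainIcc x w s})).toFinset := by
    ext s
    simp
  rw [hset, Set.ncard_eq_toFinset_card _ (Set.toFinite _), hunion, Finset.card_biUnion]
  · refine Finset.sum_congr rfl fun w hw => ?_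
    rw [← Set.ncard_eq_toFinset_card, (hinj w hw).ncard_image]
  · intro w hw w' hw' hne
    rw [Function.onFun, Finset.disjoint_left]
    intro s hs hs'
    simp only [Set.Finite.mem_toFinset, Set.mem_image, Set.mem_ofPred_eq] at hs hs'
    obtain ⟨t, ht, rfl⟩ := hs
    obtain ⟨t', ht', h⟩ := hs'
    have htt : t' = t := by
      rw [← Set.insert_sdiff_self_of_notMem (hnot w' hw' t' ht'), h,
        Set.insert_sdiff_self_of_notMem (hnot w hw t ht)]
    subst htt
    rw [Finset.mem_coe, mem_level] at hw hw'
    have hwt := right_mem_of_isMaxChainIcc ht hw.1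
    exact hne (eq_of_le_of_grade_le (ht'.prop.1 hwt).2 (by omega))

/-- Every maximal chain meets rank `k` exactly once. The induction lowers `y` to its coatoms and
exchanges the two sums. -/
theorem numMaxChains_eq_sum_level {k m : ℕ} {x y : P} (hxy : x ≤ y) (hx : grade ℕ x ≤ k)
    (hy : grade ℕ y = k + m) :
    numMaxChains x y = ∑ z ∈ level x y k, numMaxChains x z * numMaxChains z y := by
  induction m generalizing y with
  | zero =>
    rw [add_zero] at hy
    rw [← hy, level_right hxy, Finset.sum_singleton, numMaxChains_self, mul_one]
  | succ m ih =>
    have hlt : ∀ z ≤ y, grade ℕ z ≤ k → z < y := fun z hz hk =>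
      lt_of_le_of_ne hz (by rintro rfl; omega)
    calc numMaxChains x y = ∑ w ∈ level x y (k + m), numMaxChains x w :=
          numMaxChains_eq_sum_coatoms (hlt x hxy hx) hy
      _ = ∑ w ∈ level x y (k + m), ∑ z ∈ level x w k, numMaxChains x z * numMaxChains z w := by
          refine Finset.sum_congr rfl fun w hw => ?_
          rw [mem_level] at hw
          exact ih hw.1 hw.2.2
      _ = ∑ z ∈ level x y k, ∑ w ∈ level z y (k + m), numMaxChains x z * numMaxChains z w := by
          refine Finset.sum_comm' fun w z => ?_
          simp only [mem_level]
          exact ⟨fun h => ⟨⟨h.2.2.1, h.1.2⟩, h.2.1, h.2.2.1.trans h.1.2.1, h.2.2.2⟩,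
            fun h => ⟨⟨h.2.1.trans h.1.1, h.1.2⟩, h.2.1, h.1.1, h.2.2.2⟩⟩
      _ = ∑ z ∈ level x y k, numMaxChains x z * numMaxChains z y := by
          refine Finset.sum_congr rfl fun z hz => ?_
          rw [mem_level] at hz
          rw [← Finset.mul_sum, numMaxChains_eq_sum_coatoms (hlt z hz.2.1 hz.2.2.le) (k := k + m) hy]

/-- An empty level would force the chain count to be zero, but a maximal chain always exists. -/
theorem level_nonempty {k : ℕ} {x y : P} (hxy : x ≤ y) (hx : grade ℕ x ≤ k)
    (hy : k ≤ grade ℕ y) : (level x y k).Nonempty := by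
  rw [Finset.nonempty_iff_ne_empty]
  intro h
  have := numMaxChains_eq_sum_level hxy hx (Nat.add_sub_cancel' hy).symm
  rw [h, Finset.sum_empty] at this
  exact (numMaxChains_pos x y).ne' this

theorem card_level_mul {k a b : ℕ} {x y : P} (hxy : x ≤ y) (hx : grade ℕ x ≤ k)
    (hy : k ≤ grade ℕ y) (ha : ∀ z ∈ level x y k, numMaxChains x z = a)
    (hb : ∀ z ∈ level x y k, numMaxChains z y = b) :
    (level x y k).card * (a * b) = numMaxChains x y := by
  rw [numMaxChains_eq_sum_level hxy hx (Nat.add_sub_cancel' hy).symm,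
    Finset.sum_congr rfl fun z hz => by rw [ha z hz, hb z hz], Finset.sum_const, smul_eq_mul]

theorem numMaxChains_of_grade_eq_add_one {x y : P} (hxy : x ≤ y)
    (h : grade ℕ y = grade ℕ x + 1) : numMaxChains x y = 1 := by
  rw [numMaxChains_eq_sum_coatoms (covBy_of_le_of_grade hxy h).lt h, level_left hxy,
    Finset.sum_singleton, numMaxChains_self]

theorem exists_mem_level_of_card_lt {a t x x' : P} {k : ℕ} (hx : a ≤ x) (hx' : a ≤ x')
    (h : (level a t k).card < (level x t k).card + (level x' t k).card) :
    ∃ w ∈ level a t k, x ≤ w ∧ x' ≤ w := by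
  classical
  obtain ⟨w, hw⟩ := Finset.inter_nonempty_of_card_lt_card_add_card
    (level_subset hx le_rfl k) (level_subset hx' le_rfl k) h
  rw [Finset.mem_inter] at hw
  exact ⟨w, level_subset hx le_rfl k hw.1, (mem_level.1 hw.1).1, (mem_level.1 hw.2).1⟩

end Levels

/-! ### The Euler relation -/

section Eulerian

variable [BoundedOrder P] [Finite P] [GradeMinOrder ℕ P]

theorem IsEulerianPoset.sum_card_level (hP : IsEulerianPoset P) {x y : P} (hxy : x ≤ y) {n : ℕ}
    (hn : n ≠ 0) (h : grade ℕ y = grade ℕ x + n) :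
    ∑ k ∈ Finset.range (n + 1), (-1 : ℤ) ^ k * (level x y (grade ℕ x + k)).card = 0 := by
  classical
  set I : Finset P := (Set.toFinite (Set.Icc x y)).toFinset with hI
  have hmem : ∀ z, z ∈ I ↔ x ≤ z ∧ z ≤ y := by simp [hI]
  have hxy' : x < y := lt_of_le_of_ne hxy (by rintro rfl; omega)
  have hzero : ∑ z ∈ I, (-1 : ℤ) ^ grade ℕ z = 0 := by
    have hE := hP x y hxy'
    have h1 : {z ∈ Set.Icc x y | Even (grade ℕ z)} =
        (I.filter fun z => Even (grade ℕ z) : Finset P) := by ext z; simp [hmem]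
    have h2 : {z ∈ Set.Icc x y | Odd (grade ℕ z)} =
        (I.filter fun z => ¬ Even (grade ℕ z) : Finset P) := by ext z; simp [hmem]
    rw [h1, h2, Set.ncard_coe_finset, Set.ncard_coe_finset] at hE
    rw [← Finset.sum_filter_add_sum_filter_not I fun z => Even (grade ℕ z),
      Finset.sum_congr rfl fun z hz => (Finset.mem_filter.1 hz).2.neg_one_pow,
      Finset.sum_congr (s₁ := I.filter fun z => ¬ Even (grade ℕ z)) rfl fun z hz =>
        (Nat.not_even_iff_odd.1 (Finset.mem_filter.1 hz).2).neg_one_pow]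
    simp [hE]
  rw [← Finset.sum_fiberwise_of_maps_to (g := fun z => grade ℕ z - grade ℕ x)
    (t := Finset.range (n + 1))] at hzero
  · have : (-1 : ℤ) ^ grade ℕ x *
        ∑ k ∈ Finset.range (n + 1), (-1 : ℤ) ^ k * (level x y (grade ℕ x + k)).card = 0 := by
      rw [← hzero, Finset.mul_sum]
      refine Finset.sum_congr rfl fun k _ => ?_
      have hfil : I.filter (fun z => grade ℕ z - grade ℕ x = k) =
          level x y (grade ℕ x + k) := by
        ext z
        rw [Finset.mem_filter, hmem, mem_level]
        constructor
        · rintro ⟨⟨h1, h2⟩, h3⟩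
          have := grade_le_grade_of_le h1
          exact ⟨h1, h2, by omega⟩
        · rintro ⟨h1, h2, h3⟩
          exact ⟨⟨h1, h2⟩, by omega⟩
      rw [hfil, Finset.sum_congr rfl fun z hz => by rw [(mem_level.1 hz).2.2], Finset.sum_const,
        nsmul_eq_mul, pow_add]
      ring
    exact (mul_eq_zero.1 this).resolve_left (by simp)
  · intro z hz
    rw [hmem] at hz
    have := grade_le_grade_of_le hz.2
    rw [Finset.mem_range]
    omega

/-- The levels have sizes 1, f, 1, so the Euler relation gives f = 2, and each middle element
carries one chain. -/
theorem IsEulerianPoset.numMaxChains_eq_two (hP : IsEulerianPoset P) {x y : P} (hxy : x ≤ y)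
    (h : grade ℕ y = grade ℕ x + 2) : numMaxChains x y = 2 := by
  have hs := hP.sum_card_level hxy two_ne_zero h
  have hm := card_level_mul (k := grade ℕ x + 1) (a := 1) (b := 1) hxy (by omega) (by omega)
    (fun z hz => ?_) (fun z hz => ?_)
  · have hr : (level x y (grade ℕ x + 2)).card = 1 := by
      rw [← h, level_right hxy, Finset.card_singleton]
    simp only [Finset.sum_range_succ, Finset.sum_range_zero, add_zero, level_left hxy,
      Finset.card_singleton, hr] at hs
    norm_num at hs
    omega
  all_goals
    rw [mem_level] at hz
    exact numMaxChains_of_grade_eq_add_one (by tauto) (by omega)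

end Eulerian

/-! ### Factorial functions and the exceptional case -/

section Sheffer

variable [BoundedOrder P] [Finite P] [GradeMinOrder ℕ P] {B D : ℕ → ℕ}

theorem IsShefferPoset.numMaxChains_eq_binomial (hS : IsShefferPoset P B D) {n : ℕ} {x y : P}
    (hxy : x ≤ y) (hx : 0 < grade ℕ x) (h : grade ℕ y = grade ℕ x + n) :
    numMaxChains x y = B n := by
  refine hS.binomial n x y ?_ ⟨hxy, h⟩
  rintro rfl
  simp at hx

theorem IsShefferPoset.numMaxChains_bot (hS : IsShefferPoset P B D) {n : ℕ} {y : P}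
    (h : grade ℕ y = n) : numMaxChains ⊥ y = D n :=
  hS.sheffer n y ⟨bot_le, by simp [h]⟩

theorem IsShefferPoset.card_level_mul_binomial (hS : IsShefferPoset P B D) {i j k : ℕ} {x y : P}
    (hxy : x ≤ y) (hx : 0 < grade ℕ x) (hk : k = grade ℕ x + i) (hy : grade ℕ y = k + j) :
    (level x y k).card * (B i * B j) = B (i + j) := by
  rw [card_level_mul (a := B i) (b := B j) hxy (by omega) (by omega),
    hS.numMaxChains_eq_binomial (n := i + j) hxy hx (by omega)]
  all_goals
    intro z hz
    rw [mem_level] at hz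
    exact hS.numMaxChains_eq_binomial (by tauto) (by omega) (by omega)

/-- The condition `0 < i` keeps the upper interval away from the minimum, where `B` does not apply.
-/
theorem IsShefferPoset.card_level_bot_mul (hS : IsShefferPoset P B D) {i j : ℕ} {y : P}
    (hi : 0 < i) (hy : grade ℕ y = i + j) :
    (level ⊥ y i).card * (D i * B j) = D (i + j) := by
  rw [card_level_mul (a := D i) (b := B j) bot_le (by simp) (by omega),
    hS.numMaxChains_bot hy]
  all_goals
    intro z hz
    rw [mem_level] at hz
  · exact hS.numMaxChains_bot hz.2.2
  · exact hS.numMaxChains_eq_binomial hz.2.1 (by omega) (by omega)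

/-- The levels satisfy `6 f1 = 4 f2 = 6 f3` and `f1 - f2 + f3 = 2`, hence `f1 = 4`. -/
theorem IsShefferPoset.binomial_four (hS : IsShefferPoset P B D) (hP : IsEulerianPoset P)
    (h1 : B 1 = 1) (h2 : B 2 = 2) (h3 : B 3 = 6) {x y : P} (hxy : x ≤ y)
    (hx : 0 < grade ℕ x) (h : grade ℕ y = grade ℕ x + 4) : B 4 = 24 := by
  have hs := hP.sum_card_level hxy four_ne_zero h
  have hr : (level x y (grade ℕ x + 4)).card = 1 := by
    rw [← h, level_right hxy, Finset.card_singleton]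
  have e1 := hS.card_level_mul_binomial (i := 1) (j := 3) hxy hx rfl (by omega)
  have e2 := hS.card_level_mul_binomial (i := 2) (j := 2) hxy hx rfl (by omega)
  have e3 := hS.card_level_mul_binomial (i := 3) (j := 1) hxy hx rfl (by omega)
  simp only [Finset.sum_range_succ, Finset.sum_range_zero, add_zero, level_left hxy,
    Finset.card_singleton, hr] at hs
  norm_num [h1, h2, h3] at hs e1 e2 e3
  omega

/-- A rank four interval from the minimum determines `D 4` and restricts `D 3`. -/
theorem IsShefferPoset.sheffer_three (hS : IsShefferPoset P B D) (hP : IsEulerianPoset P)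
    (b1 : B 1 = 1) (b2 : B 2 = 2) (b3 : B 3 = 6) (d1 : D 1 = 1) (d2 : D 2 = 2) {y : P}
    (h : grade ℕ y = 4) :
    D 3 = 4 ∨ D 3 = 6 ∨ D 3 = 8 ∨ (D 3 = 10 ∧ D 4 = 120) := by
  have hs := hP.sum_card_level (bot_le (a := y)) four_ne_zero (by simp [h])
  have hr : (level ⊥ y 4).card = 1 := by
    rw [← h, level_right bot_le, Finset.card_singleton]
  have hbot : grade ℕ (⊥ : P) = 0 := by simp
  have h0 : (level ⊥ y 0).card = 1 := by
    rw [← hbot, level_left bot_le, Finset.card_singleton]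
  have e1 := hS.card_level_bot_mul (i := 1) (j := 3) (y := y) (by omega) (by omega)
  have e2 := hS.card_level_bot_mul (i := 2) (j := 2) (y := y) (by omega) (by omega)
  have e3 := hS.card_level_bot_mul (i := 3) (j := 1) (y := y) (by omega) (by omega)
  -- An element of rank 3 with `q` atoms below it gives `D 3 = 2q`.
  obtain ⟨w, hw⟩ := level_nonempty (k := 3) (bot_le (a := y)) (by simp) (by omega)
  have e4 := hS.card_level_bot_mul (i := 1) (j := 2) (y := w) (by omega) (mem_level.1 hw).2.2
  have hq0 := (level_nonempty (k := 1) (bot_le (a := w)) (by simp)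
    (by rw [(mem_level.1 hw).2.2]; omega)).card_pos
  simp only [Finset.sum_range_succ, Finset.sum_range_zero, hbot, zero_add,
    hr, h0] at hs
  norm_num [b1, b2, b3, d1, d2] at hs e1 e2 e3 e4
  generalize (level ⊥ y 1).card = f1 at *
  generalize (level ⊥ y 2).card = f2 at *
  generalize (level ⊥ y 3).card = f3 at *
  generalize (level ⊥ w 1).card = q at *
  -- Parity comes from `6 f1 = 4 f2`.
  obtain ⟨e, rfl⟩ : ∃ e, f1 = 2 * e := ⟨f1 / 2, by omega⟩
  obtain rfl : f2 = 3 * e := by omega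
  obtain rfl : f3 = e + 2 := by omega
  rw [← e4] at e3 ⊢
  -- The equation is now `(e + 2) q = 6 e`, impossible for `q ≥ 6`.
  have hq : q < 6 := by
    by_contra hq
    nlinarith
  interval_cases q <;> omega

/-- Suppose there are 6 or 7 atoms, and as many coatoms. Any two atoms then have a common upper
bound of rank 3. An atom `x` has only 4 covers in `[b, t]`, each above just one other atom, so there
are at most 5 atoms. -/
theorem IsShefferPoset.card_level_le_five_or (hS : IsShefferPoset P B D)
    (b1 : B 1 = 1) (b2 : B 2 = 2) (b3 : B 3 = 6) (b4 : B 4 = 24) {b t : P} (hbt : b ≤ t)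
    (hb : grade ℕ b = 1) (ht : grade ℕ t = 6) :
    (level b t 2).card ≤ 5 ∨ 8 ≤ (level b t 2).card := by
  classical
  by_contra! hc
  have hcc : (level b t 5).card = (level b t 2).card := by
    have e1 := hS.card_level_mul_binomial (i := 1) (j := 4) (k := 2) hbt (by omega) (by omega)
      (by omega)
    have e2 := hS.card_level_mul_binomial (i := 4) (j := 1) (k := 5) hbt (by omega) (by omega)
      (by omega)
    norm_num [b1, b4] at e1 e2
    omega
  have join : ∀ x ∈ level b t 2, ∀ x' ∈ level b t 2, ∃ w ∈ level b t 3, x ≤ w ∧ x' ≤ w := by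
    intro x hx x' hx'
    rw [mem_level] at hx hx'
    have c5 : ∀ v ≤ t, grade ℕ v = 2 → (level v t 5).card = 4 := by
      intro v hv hg
      have := hS.card_level_mul_binomial (i := 3) (j := 1) (k := 5) hv (by omega) (by omega)
        (by omega)
      norm_num [b1, b3, b4] at this
      omega
    -- Pigeonhole, descending one rank at a time: `4 + 4 > 7`, then `3 + 3 > 4`, then `2 + 2 > 3`.
    obtain ⟨w5, hw5, hxw5, hxw5'⟩ := exists_mem_level_of_card_lt (k := 5) (t := t) hx.1 hx'.1 (by
      rw [c5 x hx.2.1 hx.2.2, c5 x' hx'.2.1 hx'.2.2]; omega)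
    rw [mem_level] at hw5
    have c4 : ∀ v ≤ w5, grade ℕ v = 2 → (level v w5 4).card = 3 := by
      intro v hv hg
      have := hS.card_level_mul_binomial (i := 2) (j := 1) (k := 4) hv (by omega) (by omega)
        (by omega)
      norm_num [b1, b2, b3] at this
      omega
    have c4' : (level b w5 4).card = 4 := by
      have := hS.card_level_mul_binomial (i := 3) (j := 1) (k := 4) hw5.1 (by omega) (by omega)
        (by omega)
      norm_num [b1, b3, b4] at this
      omega
    obtain ⟨w4, hw4, hxw4, hxw4'⟩ := exists_mem_level_of_card_lt (k := 4) (t := w5) hx.1 hx'.1 (by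
      rw [c4 x hxw5 hx.2.2, c4 x' hxw5' hx'.2.2]; omega)
    rw [mem_level] at hw4
    have c3 : ∀ v ≤ w4, grade ℕ v = 2 → (level v w4 3).card = 2 := by
      intro v hv hg
      have := hS.card_level_mul_binomial (i := 1) (j := 1) (k := 3) hv (by omega) (by omega)
        (by omega)
      norm_num [b1, b2] at this
      omega
    have c3' : (level b w4 3).card = 3 := by
      have := hS.card_level_mul_binomial (i := 2) (j := 1) (k := 3) hw4.1 (by omega) (by omega)
        (by omega)
      norm_num [b1, b2, b3] at this
      omega
    obtain ⟨w3, hw3, hxw3⟩ := exists_mem_level_of_card_lt (k := 3) (t := w4) hx.1 hx'.1 (by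
      rw [c3 x hxw4 hx.2.2, c3 x' hxw4' hx'.2.2]; omega)
    exact ⟨w3, level_subset le_rfl (hw4.2.1.trans hw5.2.1) 3 hw3, hxw3⟩
  obtain ⟨x, hx⟩ : (level b t 2).Nonempty := Finset.card_pos.1 (by omega)
  have hx' := mem_level.1 hx
  have hsub : (level b t 2).erase x ⊆
      (level x t 3).biUnion fun w => (level b w 2).erase x := by
    intro x' hmem
    rw [Finset.mem_erase] at hmem
    obtain ⟨w, hw, h1, h2⟩ := join x hx x' hmem.2
    rw [mem_level] at hw
    rw [Finset.mem_biUnion]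
    have := mem_level.1 hmem.2
    exact ⟨w, mem_level.2 ⟨h1, hw.2⟩, Finset.mem_erase.2 ⟨hmem.1, mem_level.2 ⟨this.1, h2, this.2.2⟩⟩⟩
  have hle := (Finset.card_le_card hsub).trans (Finset.card_biUnion_le_card_mul _ _ 1 ?_)
  · have := hS.card_level_mul_binomial (i := 1) (j := 3) (k := 3) hx'.2.1 (by omega) (by omega)
      (by omega)
    norm_num [b1, b3, b4] at this
    rw [Finset.card_erase_of_mem hx] at hle
    omega
  · intro w hw
    rw [mem_level] at hw
    have := hS.card_level_mul_binomial (i := 1) (j := 1) (k := 2) (hx'.1.trans hw.1) (by omega)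
      (by omega) (by omega)
    norm_num [b1, b2] at this
    rw [Finset.card_erase_of_mem (mem_level.2 ⟨hx'.1, hw.1, hx'.2.2⟩)]
    omega

/-- The product formulas express `f2 = 5 f4` and `f3 = 4 f4`, so the Euler relation on `[⊥, t]`
involves only `f1`, `f4` and `f5`. -/
theorem IsShefferPoset.not_dodecahedral (hS : IsShefferPoset P B D) (hP : IsEulerianPoset P)
    (b1 : B 1 = 1) (b2 : B 2 = 2) (b3 : B 3 = 6) (b4 : B 4 = 24) (d1 : D 1 = 1) (d2 : D 2 = 2)
    (d3 : D 3 = 10) (d4 : D 4 = 120) {b t : P} (hbt : b ≤ t)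
    (hb : grade ℕ b = 1) (ht : grade ℕ t = 6) : False := by
  have hc := hS.card_level_le_five_or b1 b2 b3 b4 hbt hb ht
  have hc1 := hS.card_level_mul_binomial (i := 1) (j := 4) (k := 2) hbt (by omega) (by omega)
    (by omega)
  have hc4 := hS.card_level_mul_binomial (i := 4) (j := 1) (k := 5) hbt (by omega) (by omega)
    (by omega)
  -- A rank four interval `[x, y]` off the minimum has `B 4 / B 3 = 4` coatoms, all of them coatoms
  -- of `[a, y]`.
  have four_le : ∀ a x y : P, a ≤ x → x ≤ y → 0 < grade ℕ x → ∀ k, k = grade ℕ x + 3 →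
      grade ℕ y = k + 1 → 4 ≤ (level a y k).card := by
    intro a x y hax hxy hx k hk hy
    have h := hS.card_level_mul_binomial (i := 3) (j := 1) hxy hx hk hy
    norm_num [b1, b3, b4] at h
    exact le_trans (by omega) (Finset.card_le_card (level_subset hax le_rfl k))
  obtain ⟨v, hv⟩ := level_nonempty (k := 2) hbt (by omega) (by omega)
  rw [mem_level] at hv
  have hc5 := four_le b v t hv.1 hv.2.1 (by omega) 5 (by omega) (by omega)
  obtain ⟨u, hu⟩ := level_nonempty (k := 5) hbt (by omega) (by omega)
  rw [mem_level] at hu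
  have hm5 := four_le ⊥ b u bot_le hu.1 (by omega) 4 (by omega) (by omega)
  have hm := hS.card_level_bot_mul (i := 4) (j := 1) (y := u) (by omega) hu.2.2
  have hf5 : (level b t 5).card ≤ (level ⊥ t 5).card :=
    Finset.card_le_card (level_subset bot_le le_rfl 5)
  have e1 := hS.card_level_bot_mul (i := 1) (j := 5) (y := t) (by omega) ht
  have e2 := hS.card_level_bot_mul (i := 2) (j := 4) (y := t) (by omega) ht
  have e3 := hS.card_level_bot_mul (i := 3) (j := 3) (y := t) (by omega) ht
  have e4 := hS.card_level_bot_mul (i := 4) (j := 2) (y := t) (by omega) ht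
  have e5 := hS.card_level_bot_mul (i := 5) (j := 1) (y := t) (by omega) ht
  have hs := hP.sum_card_level (bot_le (a := t)) (n := 6) (by omega) (by simp [ht])
  have hr : (level ⊥ t 6).card = 1 := by
    rw [← ht, level_right bot_le, Finset.card_singleton]
  have hbot : grade ℕ (⊥ : P) = 0 := by simp
  have h0 : (level ⊥ t 0).card = 1 := by
    rw [← hbot, level_left bot_le, Finset.card_singleton]
  simp only [Finset.sum_range_succ, Finset.sum_range_zero, hbot, zero_add,
    hr, h0] at hs
  norm_num [b1, b2, b3, b4, d1, d2, d3, d4] at hs e1 e2 e3 e4 e5 hc1 hc4 hm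
  generalize (level b t 2).card = c at *
  generalize (level b t 5).card = c' at *
  generalize (level ⊥ u 4).card = m at *
  generalize (level ⊥ t 1).card = f1 at *
  generalize (level ⊥ t 2).card = f2 at *
  generalize (level ⊥ t 3).card = f3 at *
  generalize (level ⊥ t 4).card = f4 at *
  generalize (level ⊥ t 5).card = f5 at *
  rw [← hc1] at e1
  rw [← hm] at e5
  have g1 : f1 * c = 10 * f4 := by linarith
  have g5 : f5 * m = 2 * f4 := by linarith
  have key : f1 + f5 = 2 + 2 * f4 := by omega
  have hm5' := Nat.mul_le_mul_left f5 hm5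
  -- If `c ≤ 5`, then `f1 ≥ 2 f4`, so `f5 ≤ 2`, against `f5 ≥ 4`. If `c ≥ 8`, then `f1 ≤ 5 f4 / 4`,
  -- and `m ≥ 4` gives `f5 ≤ f4 / 2`, so `f1 + f5 < 2 + 2 f4`.
  rcases hc with hc | hc
  all_goals
    have hc' := Nat.mul_le_mul_left f1 hc
    clear e1 e2 e3 e4 e5 hs hc1 hc4 hm
    omega

end Sheffer

end ShefferPosets

theorem lemmad {P : Type*} [PartialOrder P] [BoundedOrder P] [Finite P] [GradeMinOrder ℕ P]
    (n : ℕ) (hn : 6 ≤ n) (hrank : grade ℕ (⊤ : P) = n)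
    (B D : ℕ → ℕ) (hSheffer : IsShefferPoset P B D) (hEulerian : IsEulerianPoset P)
    (hB : B 3 = 6) :
    D 3 = 4 ∨ D 3 = 6 ∨ D 3 = 8 := by
  obtain ⟨t, ht⟩ := level_nonempty (k := 6) (bot_le (a := (⊤ : P))) (by simp) (by omega)
  replace ht := (mem_level.1 ht).2.2
  obtain ⟨b, hb⟩ := level_nonempty (k := 1) (bot_le (a := t)) (by simp) (by omega)
  obtain ⟨-, hbt, hb⟩ := mem_level.1 hb
  -- `B` and `D` are constrained only where intervals exist, so each small value needs a witness;
  -- rank at least 6 supplies them.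
  have mid : ∀ k, 1 ≤ k → k ≤ 6 → ∃ z, b ≤ z ∧ grade ℕ z = k := by
    intro k h1 h6
    obtain ⟨z, hz⟩ := level_nonempty (k := k) hbt (by omega) (by omega)
    rw [mem_level] at hz
    exact ⟨z, hz.1, hz.2.2⟩
  obtain ⟨z2, hb2, h2⟩ := mid 2 (by omega) (by omega)
  obtain ⟨z3, hb3, h3⟩ := mid 3 (by omega) (by omega)
  obtain ⟨z4, hb4, h4⟩ := mid 4 (by omega) (by omega)
  obtain ⟨z5, hb5, h5⟩ := mid 5 (by omega) (by omega)
  have b1 : B 1 = 1 := by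
    rw [← hSheffer.numMaxChains_eq_binomial hb2 (by omega) (by omega),
      numMaxChains_of_grade_eq_add_one hb2 (by omega)]
  have b2 : B 2 = 2 := by
    rw [← hSheffer.numMaxChains_eq_binomial hb3 (by omega) (by omega),
      hEulerian.numMaxChains_eq_two hb3 (by omega)]
  have b4 : B 4 = 24 := hSheffer.binomial_four hEulerian b1 b2 hB hb5 (by omega) (by omega)
  have d1 : D 1 = 1 := by
    rw [← hSheffer.numMaxChains_bot hb, numMaxChains_of_grade_eq_add_one bot_le (by simp [hb])]
  have d2 : D 2 = 2 := by
    rw [← hSheffer.numMaxChains_bot h2, hEulerian.numMaxChains_eq_two bot_le (by simp [h2])]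
  rcases hSheffer.sheffer_three hEulerian b1 b2 hB d1 d2 h4 with h | h | h | ⟨d3, d4⟩
  · exact Or.inl h
  · exact Or.inr (Or.inl h)
  · exact Or.inr (Or.inr h)
  · exact (hSheffer.not_dodecahedral hEulerian b1 b2 hB b4 d1 d2 d3 d4 hbt hb ht).elim
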